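/- There are universal constants $c_0,c_1,c_2>0$ such that the following holds. Let $n,d\ge 1$, $A\in\mathbb R^{n\times d}$, $x^*\in\mathbb R^d$, $\sigma>0$, and $y=Ax^*+w$ with $w\in\mathbb R^n$ arbitrary (for instance, any realization of a noise vector with distribution $N(0,\sigma^2 I_n)$ that is independent of the sketches). Write $\|v\|_A=\frac1{\sqrt n}\|Av\|_2$, and let $x^{LS}$ be a minimizer of $\frac1{2n}\|Ax-y\|_2^2$ over $\mathbb R^d$. Fix $\rho\in(0,1/2)$ and put $$N=1+\max\Big\{0,\Big\lceil\frac{\log\big(\sqrt n\,\|x^{LS}\|_A/\sigma\big)}{\log(1/\rho)}\Big\rceil\Big\}$$ (with $N=1$ if $\|x^{LS}\|_A=0$). Let $m\ge \frac{c_0}{\rho^2}d$ be an integer, and let $S^1,\dots,S^N\in\mathbb R^{m\times n}$ be independent sub-Gaussian sketches: each has i.i.d. rows $s$ with $\mathbb E[s]=0$, $\operatorname{cov}(s)=I_n$ and $\mathbb P[\langle s,u\rangle\ge\varepsilon\|u\|_2]\le e^{-\varepsilon^2/2}$ for all $u\ne0$ and $\varepsilon\ge0$. The iterative Hessian sketch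 (IHS) starts at $x^0=0$ and, for $t=0,\dots,N-1$, takes $$x^{t+1}\in\arg\min_{x\in\mathbb R^d}\Big\{\frac1{2m}\|S^{t+1}A(x-x^t)\|_2^2-\langle A^T(y-Ax^t),x\rangle\Big\}.$$ Then there is an event of probability greater than $1-c_1Ne^{-c_2m\rho^2}$, and, if $d\ge2$, also greater than $1-c_1N\exp\!\big(-c_2\frac{m\rho^2}{\log^4 d}\big)$, on which the IHS can be run for $N$ rounds and the output $\hat x=x^N$ of every such run satisfies $$\|\hat x-x^{LS}\|_A\le\sqrt{\frac{\sigma^2d}{n}}\qquad\text{and}\qquad\|x^N-x^*\|_A\le\sqrt{\frac{\sigma^2d}{n}}+\|x^{LS}-x^*\|_A .$$ -/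

import Mathlib

open MeasureTheory ProbabilityTheory

noncomputable section

namespace IHS

/-- The prediction semi-norm `‖v‖_A = ‖A v‖₂ / √n` attached to a data matrix `A`. -/
def predNorm {n d : ℕ} (A : Matrix (Fin n) (Fin d) ℝ) (v : EuclideanSpace ℝ (Fin d)) : ℝ :=
  ‖Matrix.toEuclideanLin A v‖ / √(n : ℝ)

/-- `x` is a solution of the least-squares problem over the constraint set `C`, i.e. a minimizer
over `C` of `f(x) = (1 / (2n)) ‖A x - y‖₂²`. -/
def IsLeastSquaresSol {n d : ℕ} (C : Set (EuclideanSpace ℝ (Fin d)))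
    (A : Matrix (Fin n) (Fin d) ℝ) (y : EuclideanSpace ℝ (Fin n))
    (x : EuclideanSpace ℝ (Fin d)) : Prop :=
  x ∈ C ∧
    IsMinOn (fun z => 1 / (2 * (n : ℝ)) * ‖Matrix.toEuclideanLin A z - y‖ ^ 2) C x

/-- The objective function minimized in one round of the iterative Hessian sketch:
`x ↦ (1 / (2m)) ‖S A (x - x_t)‖₂² - ⟨Aᵀ (y - A x_t), x⟩`, where `S` is the sketch matrix of that
round and `xt` the current iterate. -/
def objective {m n d : ℕ} (A : Matrix (Fin n) (Fin d) ℝ) (y : EuclideanSpace ℝ (Fin n))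
    (S : Matrix (Fin m) (Fin n) ℝ) (xt x : EuclideanSpace ℝ (Fin d)) : ℝ :=
  1 / (2 * (m : ℝ)) * ‖Matrix.toEuclideanLin (S * A) (x - xt)‖ ^ 2
    - inner ℝ (Matrix.toEuclideanLin A.transpose (y - Matrix.toEuclideanLin A xt)) x

/-- `x 0, x 1, …, x N` are the iterates of a run of the iterative Hessian sketch over `C` with the
sketch matrices `S 0, …, S (N - 1)`: the run starts at `0`, and each iterate `x (t + 1)` minimizes
over `C` the objective given by `S t` and `x t`. -/
def IsRun {m n d N : ℕ} (C : Set (EuclideanSpace ℝ (Fin d)))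
    (A : Matrix (Fin n) (Fin d) ℝ) (y : EuclideanSpace ℝ (Fin n))
    (S : Fin N → Matrix (Fin m) (Fin n) ℝ) (x : Fin (N + 1) → EuclideanSpace ℝ (Fin d)) : Prop :=
  x 0 = 0 ∧
    ∀ t : Fin N, x t.succ ∈ C ∧ IsMinOn (objective A y (S t) (x t.castSucc)) C (x t.succ)

/-- A zero-mean random vector `s` in `ℝⁿ` is `1`-sub-Gaussian if
`ℙ[⟨s, u⟩ ≥ ε ‖u‖₂] ≤ exp (-ε² / 2)` for all `u ≠ 0` and all `ε ≥ 0`. -/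
structure IsOneSubGaussian {Ω : Type*} [MeasurableSpace Ω] {n : ℕ}
    (s : Ω → EuclideanSpace ℝ (Fin n)) (μ : Measure Ω) : Prop where
  integrable : Integrable s μ
  zero_mean : ∫ ω, s ω ∂μ = 0
  tail : ∀ u : EuclideanSpace ℝ (Fin n), u ≠ 0 → ∀ ε : ℝ, 0 ≤ ε →
    μ.real {ω | ε * ‖u‖ ≤ inner ℝ (s ω) u} ≤ Real.exp (-ε ^ 2 / 2)

/-- The `i`-th row of a random matrix, as a random vector in Euclidean space. -/
def row {Ω : Type*} {m n : ℕ} (S : Ω → Matrix (Fin m) (Fin n) ℝ) (i : Fin m) (ω : Ω) :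
    EuclideanSpace ℝ (Fin n) :=
  WithLp.toLp 2 (S ω i)

/-- Matrices carry the product (entrywise Borel) sigma-algebra. -/
instance instMeasurableSpaceMatrix {m n : ℕ} : MeasurableSpace (Matrix (Fin m) (Fin n) ℝ) :=
  inferInstanceAs (MeasurableSpace (Fin m → Fin n → ℝ))

/-- A sub-Gaussian sketch: a random `m × n` matrix whose rows are i.i.d., zero-mean,
`1`-sub-Gaussian, and have covariance matrix `I_n`. -/
structure IsSubGaussianSketch {Ω : Type*} [MeasurableSpace Ω] {m n : ℕ}
    (S : Ω → Matrix (Fin m) (Fin n) ℝ) (μ : Measure Ω) : Prop where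
  measurable : Measurable S
  indep : iIndepFun (row S) μ
  identDistrib : ∀ i i' : Fin m, IdentDistrib (row S i) (row S i') μ μ
  subGaussian : ∀ i : Fin m, IsOneSubGaussian (row S i) μ
  memLp : ∀ i : Fin m, MemLp (row S i) 2 μ
  cov : ∀ (i : Fin m) (j k : Fin n),
    covariance (fun ω => row S i ω j) (fun ω => row S i ω k) μ = if j = k then 1 else 0

end IHS

end

/-!
Let `a t = A (x t - xLS)` be the prediction error after `t` rounds and `Q = Sᵀ S / m` the sketched
identity of a round. The first-order conditions of the round and of least squares combine into
`⟨Q a (t + 1), v⟩ = ⟨(Q - 1) a t, v⟩` for all `v` in the range `U` of `A`. If `Q - 1` has norm at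
most `ρ / 2` on `U` (`PreservesInner`), then `v = a (t + 1)` gives `‖a (t + 1)‖ ≤ ρ ‖a t‖`
(`PreservesInner.norm_sub_le`), and a minimizer exists because `S` is injective on `U`
(`PreservesInner.exists_isMinOn_objective`). Since `a 0 = -A xLS`, the choice of `N` makes the last
error at most `σ ≤ σ √d`.

It remains to see that each sketch satisfies `PreservesInner` with high probability; a union bound
over the rounds then suffices. For fixed `u`, the quantity `‖S u‖² / ‖u‖² - m` is a sum of i.i.d.
centred squares of sub-Gaussian variables. Their moment generating function at `l` is at most
`exp (K l²)` for small `l` (`mgf_sq_sub_one_le`), so Chernoff's method yields the deviation bound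
`2 exp (-m δ² / (4 K))` for every `δ ≤ 1` (`measureReal_abs_sum_sq_sub_one_ge_le`). A net of at most
`5 ^ d` points of the ball of radius `2` in `U` reduces the norm of `Q - 1` on `U`, through
polarization, to at most `2 * 25 ^ d` such deviations (`exists_test_vectors`), and for
`m ≥ c₀ d / ρ²` the factor `25 ^ d` is absorbed by half of the exponent
(`IsSubGaussianSketch.exists_event_preservesInner`). This proves the bound without a logarithm; the
one with `log⁴ d` follows because `log d ≥ log 2`.
-/

namespace IHS

open Module
open scoped NNReal ENNReal

/-! ### First-order conditions and contraction of one round -/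

theorem eq_zero_of_forall_quadratic_nonneg {a b : ℝ} (h : ∀ s : ℝ, 0 ≤ a * s ^ 2 + b * s) :
    b = 0 := by
  have h1 := discrim_le_zero (a := a) (b := b) (c := 0) fun s => by linarith [h s, sq s]
  have h2 : b ^ 2 ≤ 0 := by simpa [discrim] using h1
  exact pow_eq_zero_iff two_ne_zero |>.1 (le_antisymm h2 (sq_nonneg b))

variable {m n d : ℕ}

theorem inner_toEuclideanLin_transpose (A : Matrix (Fin n) (Fin d) ℝ)
    (u : EuclideanSpace ℝ (Fin n)) (v : EuclideanSpace ℝ (Fin d)) :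
    inner ℝ (Matrix.toEuclideanLin A.transpose u) v = inner ℝ u (Matrix.toEuclideanLin A v) := by
  have h := Matrix.toEuclideanLin_conjTranspose_eq_adjoint A
  rw [Matrix.conjTranspose_eq_transpose_of_trivial] at h
  rw [h, LinearMap.adjoint_inner_left]

theorem toEuclideanLin_mul_apply (S : Matrix (Fin m) (Fin n) ℝ) (A : Matrix (Fin n) (Fin d) ℝ)
    (v : EuclideanSpace ℝ (Fin d)) :
    Matrix.toEuclideanLin (S * A) v = Matrix.toEuclideanLin S (Matrix.toEuclideanLin A v) := by
  simp [Matrix.toLpLin_apply, Matrix.mulVec_mulVec]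

/-- The second-order Taylor expansion of the objective around `x`, which is exact. -/
theorem objective_add (A : Matrix (Fin n) (Fin d) ℝ) (y : EuclideanSpace ℝ (Fin n))
    (S : Matrix (Fin m) (Fin n) ℝ) (x₀ x v : EuclideanSpace ℝ (Fin d)) :
    objective A y S x₀ (x + v) = objective A y S x₀ x
      + 1 / (2 * (m : ℝ)) * ‖Matrix.toEuclideanLin (S * A) v‖ ^ 2
      + ((m : ℝ)⁻¹ * inner ℝ (Matrix.toEuclideanLin (S * A) (x - x₀))
            (Matrix.toEuclideanLin (S * A) v)
          - inner ℝ (y - Matrix.toEuclideanLin A x₀) (Matrix.toEuclideanLin A v)) := by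
  have h : x + v - x₀ = (x - x₀) + v := by abel
  rw [objective, objective, h, map_add, norm_add_sq_real, inner_add_right,
    inner_toEuclideanLin_transpose, inner_toEuclideanLin_transpose]
  rcases eq_or_ne (m : ℝ) 0 with hm | hm
  · simp [hm]; ring
  · field_simp; ring

theorem isMinOn_objective_iff (A : Matrix (Fin n) (Fin d) ℝ) (y : EuclideanSpace ℝ (Fin n))
    (S : Matrix (Fin m) (Fin n) ℝ) (x₀ x : EuclideanSpace ℝ (Fin d)) :
    IsMinOn (objective A y S x₀) Set.univ x ↔
      ∀ v, (m : ℝ)⁻¹ * inner ℝ (Matrix.toEuclideanLin (S * A) (x - x₀))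
            (Matrix.toEuclideanLin (S * A) v)
          = inner ℝ (y - Matrix.toEuclideanLin A x₀) (Matrix.toEuclideanLin A v) := by
  rw [isMinOn_univ_iff]
  constructor
  · intro h v
    refine sub_eq_zero.1 (eq_zero_of_forall_quadratic_nonneg
      (a := 1 / (2 * (m : ℝ)) * ‖Matrix.toEuclideanLin (S * A) v‖ ^ 2) fun s => ?_)
    have h1 := h (x + s • v)
    rw [objective_add, map_smul, map_smul, inner_smul_right, inner_smul_right, norm_smul,
      mul_pow, Real.norm_eq_abs, sq_abs] at h1
    linarith
  · intro h z
    have h1 := objective_add A y S x₀ x (z - x)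
    rw [add_sub_cancel, h, sub_self, add_zero] at h1
    rw [h1]
    exact le_add_of_nonneg_right (by positivity)

theorem IsLeastSquaresSol.inner_residual_eq_zero (hn : 1 ≤ n) {A : Matrix (Fin n) (Fin d) ℝ}
    {y : EuclideanSpace ℝ (Fin n)} {x : EuclideanSpace ℝ (Fin d)}
    (h : IsLeastSquaresSol Set.univ A y x) (v : EuclideanSpace ℝ (Fin d)) :
    inner ℝ (Matrix.toEuclideanLin A x - y) (Matrix.toEuclideanLin A v) = 0 := by
  have hn' : (0 : ℝ) < n := by exact_mod_cast hn
  refine eq_zero_of_forall_quadratic_nonneg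
    (a := 1 / 2 * ‖Matrix.toEuclideanLin A v‖ ^ 2) fun s => ?_
  have h1 := isMinOn_univ_iff.1 h.2 (x + s • v)
  have h2 : Matrix.toEuclideanLin A (x + s • v) - y
      = (Matrix.toEuclideanLin A x - y) + s • Matrix.toEuclideanLin A v := by
    rw [map_add, map_smul]; abel
  simp only [h2] at h1
  have h3 := le_of_mul_le_mul_left h1 (by positivity)
  rw [norm_add_sq_real, inner_smul_right, norm_smul, mul_pow, Real.norm_eq_abs, sq_abs] at h3
  linarith

/-- The sketch `S` preserves the geometry of the subspace `U` with relative error `δ`: the form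
`(u, v) ↦ ⟨S u, S v⟩ / m - ⟨u, v⟩` has norm at most `δ` on `U`. -/
def PreservesInner (S : Matrix (Fin m) (Fin n) ℝ) (U : Submodule ℝ (EuclideanSpace ℝ (Fin n)))
    (δ : ℝ) : Prop :=
  ∀ u ∈ U, ∀ v ∈ U,
    |(m : ℝ)⁻¹ * inner ℝ (Matrix.toEuclideanLin S u) (Matrix.toEuclideanLin S v) - inner ℝ u v|
      ≤ δ * ‖u‖ * ‖v‖

theorem PreservesInner.eq_zero {S : Matrix (Fin m) (Fin n) ℝ}
    {U : Submodule ℝ (EuclideanSpace ℝ (Fin n))} {δ : ℝ} (h : PreservesInner S U δ) (hδ : δ < 1)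
    {u : EuclideanSpace ℝ (Fin n)} (hu : u ∈ U) (hSu : Matrix.toEuclideanLin S u = 0) : u = 0 := by
  have h1 := h u hu u hu
  rw [hSu, inner_zero_left, mul_zero, zero_sub, abs_neg, real_inner_self_eq_norm_sq,
    abs_of_nonneg (sq_nonneg _)] at h1
  have h2 : (1 - δ) * ‖u‖ ^ 2 ≤ 0 := by linarith [sq ‖u‖]
  have h3 : ‖u‖ ^ 2 ≤ 0 := by
    by_contra h4
    exact absurd h2 (not_le.2 (mul_pos (by linarith) (not_le.1 h4)))
  exact norm_eq_zero.1 (pow_eq_zero_iff two_ne_zero |>.1 (le_antisymm h3 (sq_nonneg _)))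

/-- If the sketch is injective on the range of `A`, the round has a minimizer: the gradient
`Aᵀ (y - A x₀)` is orthogonal to `ker (S A) = ker A`, so it lies in the range of `(S A)ᵀ (S A)`. -/
theorem PreservesInner.exists_isMinOn_objective {S : Matrix (Fin m) (Fin n) ℝ}
    {A : Matrix (Fin n) (Fin d) ℝ} {δ : ℝ}
    (h : PreservesInner S (LinearMap.range (Matrix.toEuclideanLin A)) δ) (hδ : δ < 1) (hm : m ≠ 0)
    (y : EuclideanSpace ℝ (Fin n)) (x₀ : EuclideanSpace ℝ (Fin d)) :
    ∃ x, IsMinOn (objective A y S x₀) Set.univ x := by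
  set L := Matrix.toEuclideanLin (S * A) with hL
  set b := Matrix.toEuclideanLin A.transpose (y - Matrix.toEuclideanLin A x₀) with hb
  have hbmem : b ∈ LinearMap.range (L.adjoint ∘ₗ L) := by
    rw [LinearMap.range_adjoint_comp_self, ← LinearMap.orthogonal_ker,
      Submodule.mem_orthogonal']
    intro v hv
    have hv' : Matrix.toEuclideanLin S (Matrix.toEuclideanLin A v) = 0 := by
      rw [← toEuclideanLin_mul_apply]; exact hv
    rw [hb, inner_toEuclideanLin_transpose, h.eq_zero hδ (LinearMap.mem_range_self _ v) hv',
      inner_zero_right]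
  obtain ⟨z, hz⟩ := hbmem
  refine ⟨x₀ + (m : ℝ) • z, (isMinOn_objective_iff A y S x₀ _).2 fun v => ?_⟩
  rw [add_sub_cancel_left, ← hL, map_smul, inner_smul_left, ← inner_toEuclideanLin_transpose A, ← hb,
    ← hz, LinearMap.comp_apply, LinearMap.adjoint_inner_left]
  have : (m : ℝ) ≠ 0 := by exact_mod_cast hm
  simp [this]

/-- One round contracts the error by `ρ`. With `a = A (x₀ - xLS)`, `a' = A (x - xLS)` and
`Q = Sᵀ S / m`, the two first-order conditions give `⟨Q a', v⟩ = ⟨(Q - 1) a, v⟩` on the range of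
`A`; take `v = a'`. -/
theorem PreservesInner.norm_sub_le (hn : 1 ≤ n) {S : Matrix (Fin m) (Fin n) ℝ}
    {A : Matrix (Fin n) (Fin d) ℝ} {ρ : ℝ} (hρ : 0 < ρ) (hρ' : ρ < 1 / 2)
    (h : PreservesInner S (LinearMap.range (Matrix.toEuclideanLin A)) (ρ / 2))
    {y : EuclideanSpace ℝ (Fin n)} {x₀ x xLS : EuclideanSpace ℝ (Fin d)}
    (hLS : IsLeastSquaresSol Set.univ A y xLS)
    (hx : IsMinOn (objective A y S x₀) Set.univ x) :
    ‖Matrix.toEuclideanLin A (x - xLS)‖ ≤ ρ * ‖Matrix.toEuclideanLin A (x₀ - xLS)‖ := by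
  set a := Matrix.toEuclideanLin A (x₀ - xLS) with ha
  set a' := Matrix.toEuclideanLin A (x - xLS) with ha'
  have h1 := (isMinOn_objective_iff A y S x₀ x).1 hx (x - xLS)
  have h2 := hLS.inner_residual_eq_zero hn (x - xLS)
  rw [toEuclideanLin_mul_apply, toEuclideanLin_mul_apply, ← ha',
    show x - x₀ = (x - xLS) - (x₀ - xLS) by abel, map_sub (Matrix.toEuclideanLin A), ← ha, ← ha',
    map_sub, inner_sub_left, inner_sub_left] at h1
  rw [← ha', inner_sub_left] at h2
  have h3 : inner ℝ a a' = inner ℝ (Matrix.toEuclideanLin A x₀) a'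
      - inner ℝ (Matrix.toEuclideanLin A xLS) a' := by
    rw [ha, map_sub, inner_sub_left]
  have b1 := (abs_le.1 (h a' (LinearMap.mem_range_self _ _) a' (LinearMap.mem_range_self _ _))).1
  have b2 := (abs_le.1 (h a (LinearMap.mem_range_self _ _) a' (LinearMap.mem_range_self _ _))).2
  rw [real_inner_self_eq_norm_sq a'] at b1
  have h4 : (1 - ρ / 2) * ‖a'‖ * ‖a'‖ ≤ ρ / 2 * ‖a‖ * ‖a'‖ := by
    linarith [sq ‖a'‖]
  rcases (norm_nonneg a').eq_or_lt with h0 | h0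
  · rw [← h0]; positivity
  · have h5 := le_of_mul_le_mul_right h4 h0
    have h6 : 0 ≤ (1 / 2 - ρ / 2) * ‖a'‖ := mul_nonneg (by linarith) h0.le
    linarith

/-! ### Reduction to finitely many test vectors -/

section Net
variable {E : Type*} [NormedAddCommGroup E] [NormedSpace ℝ E] [FiniteDimensional ℝ E]

/-- A maximal `1`-separated subset of the ball of radius `2` is a `1`-net of it, and a volume
argument bounds its cardinality. -/
theorem exists_one_net_two_ball (E : Type*) [NormedAddCommGroup E] [NormedSpace ℝ E]
    [FiniteDimensional ℝ E] :
    ∃ P : Finset E, (∀ p ∈ P, ‖p‖ ≤ 2) ∧ (∀ x : E, ‖x‖ ≤ 2 → ∃ p ∈ P, ‖x - p‖ ≤ 1) ∧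
      P.card ≤ 5 ^ finrank ℝ E := by
  have hle : ∀ C : Set E, C ⊆ Metric.closedBall 0 2 → Metric.IsSeparated (1 : ℝ≥0) C →
      C.encard ≤ (5 ^ finrank ℝ E : ℕ) := by
    intro C hC hsep
    by_contra hlt
    rw [not_le] at hlt
    -- the volume bound is for finite sets, so it is applied to a subset with one point too many
    have hlt' := Order.add_one_le_of_lt hlt
    obtain ⟨T, hTC, hT⟩ := Set.exists_subset_encard_eq hlt'
    have hTfin : T.Finite :=
      Set.finite_of_encard_eq_coe (k := 5 ^ finrank ℝ E + 1) (by simpa using hT)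
    have := Besicovitch.card_le_of_separated hTfin.toFinset
      (fun c hc => by simpa using hC (hTC (hTfin.mem_toFinset.1 hc)))
      (fun c hc d hd hcd => by
        have := hsep (hTC (hTfin.mem_toFinset.1 hc)) (hTC (hTfin.mem_toFinset.1 hd)) hcd
        have h1 : (1 : ℝ≥0∞) < edist c d := by simpa using this
        rw [edist_dist, ← ENNReal.ofReal_one, ENNReal.ofReal_lt_ofReal_iff_of_nonneg zero_le_one,
          dist_eq_norm] at h1
        exact h1.le)
    rw [hTfin.encard_eq_coe_toFinset_card] at hT
    have h2 : hTfin.toFinset.card = 5 ^ finrank ℝ E + 1 := by exact_mod_cast hT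
    omega
  have hpack : Metric.packingNumber (1 : ℝ≥0) (Metric.closedBall (0 : E) 2)
      ≤ (5 ^ finrank ℝ E : ℕ) := iSup₂_le fun C hC => iSup_le fun hs => hle C hC hs
  have htop : Metric.packingNumber (1 : ℝ≥0) (Metric.closedBall (0 : E) 2) ≠ ⊤ :=
    ne_top_of_le_ne_top (ENat.natCast_ne_top _) hpack
  rw [← Metric.encard_maximalSeparatedSet htop] at hpack
  have hfin := Set.finite_of_encard_le_coe hpack
  refine ⟨hfin.toFinset, fun p hp => ?_, fun x hx => ?_, ?_⟩
  · simpa using Metric.maximalSeparatedSet_subset (hfin.mem_toFinset.1 hp)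
  · obtain ⟨p, hp, hxp⟩ := Metric.isCover_maximalSeparatedSet htop
      (show x ∈ Metric.closedBall (0 : E) 2 by simpa using hx)
    refine ⟨p, hfin.mem_toFinset.2 hp, ?_⟩
    have h1 : edist x p ≤ 1 := by simpa using hxp
    rw [edist_dist, ← ENNReal.ofReal_one, ENNReal.ofReal_le_ofReal_iff zero_le_one,
      dist_eq_norm] at h1
    exact h1
  · rw [hfin.encard_eq_coe_toFinset_card] at hpack
    exact_mod_cast hpack

/-- A bound for a functional on a `1`-net of the ball of radius `2` is one for its norm: the points
of the sphere of radius `2` give `2 ‖φ‖ ≤ c + ‖φ‖`. -/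
theorem abs_le_of_net {P : Finset E} (hP : ∀ x : E, ‖x‖ ≤ 2 → ∃ p ∈ P, ‖x - p‖ ≤ 1)
    (φ : E →ₗ[ℝ] ℝ) {c : ℝ} (hφ : ∀ p ∈ P, |φ p| ≤ c) (x : E) : |φ x| ≤ c * ‖x‖ := by
  set ψ := LinearMap.toContinuousLinearMap φ with hψ
  have hc : 0 ≤ c := by
    obtain ⟨p, hp, -⟩ := hP 0 (by simp)
    exact (abs_nonneg _).trans (hφ p hp)
  have h1 : ‖ψ‖ ≤ (c + ‖ψ‖) / 2 := by
    refine ψ.opNorm_le_of_unit_norm (by positivity) fun z hz => ?_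
    obtain ⟨p, hp, hzp⟩ := hP ((2 : ℝ) • z) (by rw [norm_smul, hz]; simp)
    have h2 : ψ ((2 : ℝ) • z) = ψ p + ψ ((2 : ℝ) • z - p) := by rw [map_sub]; ring
    have h3 : ‖ψ ((2 : ℝ) • z - p)‖ ≤ ‖ψ‖ * 1 := (ψ.le_opNorm _).trans (by gcongr)
    have h4 : ‖ψ ((2 : ℝ) • z)‖ ≤ c + ‖ψ‖ := by
      rw [h2]
      refine (norm_add_le _ _).trans (add_le_add (hφ p hp) (by linarith))
    rw [map_smul, norm_smul, Real.norm_ofNat] at h4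
    linarith
  have h5 : ‖ψ‖ ≤ c := by linarith
  exact (ψ.le_opNorm x).trans (by gcongr)

end Net

/-- The form `(u, v) ↦ ⟨S u, S v⟩ / m - ⟨u, v⟩` of `PreservesInner`. -/
noncomputable def sketchDefect (S : Matrix (Fin m) (Fin n) ℝ) :
    EuclideanSpace ℝ (Fin n) →ₗ[ℝ] EuclideanSpace ℝ (Fin n) →ₗ[ℝ] ℝ :=
  (m : ℝ)⁻¹ • (innerₗ (EuclideanSpace ℝ (Fin m))).compl₁₂ (Matrix.toEuclideanLin S)
    (Matrix.toEuclideanLin S) - innerₗ (EuclideanSpace ℝ (Fin n))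

theorem sketchDefect_apply (S : Matrix (Fin m) (Fin n) ℝ) (u v : EuclideanSpace ℝ (Fin n)) :
    sketchDefect S u v = (m : ℝ)⁻¹ * inner ℝ (Matrix.toEuclideanLin S u)
      (Matrix.toEuclideanLin S v) - inner ℝ u v := by
  simp [sketchDefect]

/-- Polarization: the form is controlled at `(p, q)` by its diagonal at `p + q` and `p - q`. -/
theorem abs_sketchDefect_le (S : Matrix (Fin m) (Fin n) ℝ) {δ : ℝ} {p q : EuclideanSpace ℝ (Fin n)}
    (hp : ‖p‖ ≤ 2) (hq : ‖q‖ ≤ 2) (hδ : 0 ≤ δ)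
    (h₁ : |sketchDefect S (p + q) (p + q)| ≤ δ * ‖p + q‖ ^ 2)
    (h₂ : |sketchDefect S (p - q) (p - q)| ≤ δ * ‖p - q‖ ^ 2) :
    |sketchDefect S p q| ≤ 4 * δ := by
  have hsymm : sketchDefect S q p = sketchDefect S p q := by
    simp only [sketchDefect_apply, real_inner_comm]
  have hpol : 4 * sketchDefect S p q
      = sketchDefect S (p + q) (p + q) - sketchDefect S (p - q) (p - q) := by
    simp only [map_add, map_sub, LinearMap.add_apply, LinearMap.sub_apply, hsymm]
    ring
  have hpar : ‖p + q‖ ^ 2 + ‖p - q‖ ^ 2 ≤ 16 := by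
    rw [norm_add_sq_real, norm_sub_sq_real]
    nlinarith [norm_nonneg p, norm_nonneg q]
  have := mul_le_mul_of_nonneg_left hpar hδ
  rw [abs_le] at *
  constructor <;> linarith [h₁.1, h₁.2, h₂.1, h₂.2]

/-- It suffices to control the quadratic form of the sketch on a finite set of test vectors, whose
size depends only on the dimension of the subspace. -/
theorem exists_test_vectors (U : Submodule ℝ (EuclideanSpace ℝ (Fin n))) :
    ∃ T : Finset (EuclideanSpace ℝ (Fin n)), T.card ≤ 2 * 25 ^ finrank ℝ U ∧
      ∀ (m : ℕ) (S : Matrix (Fin m) (Fin n) ℝ) (δ : ℝ), 0 ≤ δ →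
        (∀ u ∈ T, |sketchDefect S u u| ≤ δ * ‖u‖ ^ 2) → PreservesInner S U (4 * δ) := by
  classical
  obtain ⟨P, hP2, hPnet, hPcard⟩ := exists_one_net_two_ball U
  refine ⟨(P ×ˢ P).image (fun z => (z.1 + z.2 : EuclideanSpace ℝ (Fin n))) ∪
    (P ×ˢ P).image (fun z => (z.1 - z.2 : EuclideanSpace ℝ (Fin n))), ?_, ?_⟩
  · have hPP : (P ×ˢ P).card ≤ 25 ^ finrank ℝ U := by
      rw [Finset.card_product]
      calc P.card * P.card ≤ 5 ^ finrank ℝ U * 5 ^ finrank ℝ U := Nat.mul_le_mul hPcard hPcard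
        _ = 25 ^ finrank ℝ U := by rw [← mul_pow]; norm_num
    calc _ ≤ _ := Finset.card_union_le _ _
      _ ≤ (P ×ˢ P).card + (P ×ˢ P).card := add_le_add Finset.card_image_le Finset.card_image_le
      _ ≤ 2 * 25 ^ finrank ℝ U := by omega
  · intro m S δ hδ hT
    have hnet : ∀ p ∈ P, ∀ q ∈ P, |sketchDefect S p q| ≤ 4 * δ := fun p hp q hq =>
      abs_sketchDefect_le S (hP2 p hp) (hP2 q hq) hδ
        (hT _ (Finset.mem_union_left _ (Finset.mem_image.2 ⟨(p, q), by simp [hp, hq], rfl⟩)))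
        (hT _ (Finset.mem_union_right _ (Finset.mem_image.2 ⟨(p, q), by simp [hp, hq], rfl⟩)))
    have hright : ∀ p ∈ P, ∀ v : U, |sketchDefect S p v| ≤ 4 * δ * ‖v‖ := fun p hp v =>
      abs_le_of_net hPnet ((sketchDefect S p).comp U.subtype) (hnet p hp) v
    intro u hu v hv
    have := abs_le_of_net hPnet (((sketchDefect S).flip v).comp U.subtype)
      (fun p hp => hright p hp ⟨v, hv⟩) ⟨u, hu⟩
    rw [← sketchDefect_apply]
    calc _ ≤ 4 * δ * ‖v‖ * ‖u‖ := this
      _ = 4 * δ * ‖u‖ * ‖v‖ := by ring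

/-! ### Concentration of sums of squares of sub-Gaussian variables -/

section Tail
variable {Ω : Type*} [MeasurableSpace Ω] {μ : Measure Ω} [IsProbabilityMeasure μ]

/-- A bound for `𝔼 exp (X² / 4)` when both tails of `X` are dominated by `exp (-ε² / 2)`. The `k`-th
term bounds `exp ((k + 1) / 4) * ℙ[k ≤ X²]`, the contribution of `⌊X²⌋ = k`. -/
noncomputable def expSqBound : ℝ := ∑' k : ℕ, 2 * Real.exp (1 / 4) * Real.exp (-1 / 4) ^ k

theorem summable_expSqBound :
    Summable fun k : ℕ => 2 * Real.exp (1 / 4) * Real.exp (-1 / 4) ^ k :=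
  (summable_geometric_of_lt_one (Real.exp_pos _).le
    ((Real.exp_lt_exp.2 (by norm_num)).trans_eq Real.exp_zero)).mul_left _

theorem one_le_expSqBound : 1 ≤ expSqBound := by
  refine le_trans ?_ (summable_expSqBound.le_tsum 0 fun k _ => by positivity)
  have : (1 : ℝ) ≤ Real.exp (1 / 4) := Real.one_le_exp (by norm_num)
  simpa using by linarith

theorem measureReal_le_sq_le {X : Ω → ℝ}
    (h₁ : ∀ ε : ℝ, 0 ≤ ε → μ.real {ω | ε ≤ X ω} ≤ Real.exp (-ε ^ 2 / 2))
    (h₂ : ∀ ε : ℝ, 0 ≤ ε → μ.real {ω | ε ≤ -X ω} ≤ Real.exp (-ε ^ 2 / 2)) {t : ℝ} (ht : 0 ≤ t) :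
    μ.real {ω | t ≤ X ω ^ 2} ≤ 2 * Real.exp (-t / 2) := by
  have hsub : {ω | t ≤ X ω ^ 2} ⊆ {ω | √t ≤ X ω} ∪ {ω | √t ≤ -X ω} := fun ω hω => by
    have : √t ≤ |X ω| := Real.sqrt_le_left (abs_nonneg _) |>.2 (by rw [sq_abs]; exact hω)
    exact le_abs.1 this
  have e₁ := h₁ _ (Real.sqrt_nonneg t)
  have e₂ := h₂ _ (Real.sqrt_nonneg t)
  rw [Real.sq_sqrt ht] at e₁ e₂
  calc _ ≤ _ := measureReal_mono hsub
    _ ≤ _ := measureReal_union_le _ _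
    _ ≤ _ := by linarith

theorem lintegral_exp_sq_le {X : Ω → ℝ} (hX : Measurable X)
    (h₁ : ∀ ε : ℝ, 0 ≤ ε → μ.real {ω | ε ≤ X ω} ≤ Real.exp (-ε ^ 2 / 2))
    (h₂ : ∀ ε : ℝ, 0 ≤ ε → μ.real {ω | ε ≤ -X ω} ≤ Real.exp (-ε ^ 2 / 2)) :
    ∫⁻ ω, ENNReal.ofReal (Real.exp (X ω ^ 2 / 4)) ∂μ ≤ ENNReal.ofReal expSqBound := by
  have hmeas : ∀ k : ℕ, MeasurableSet {ω | (k : ℝ) ≤ X ω ^ 2} := fun k =>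
    measurableSet_le measurable_const (hX.pow_const 2)
  have hpt : ∀ ω, ENNReal.ofReal (Real.exp (X ω ^ 2 / 4)) ≤ ∑' k : ℕ,
      {ω | (k : ℝ) ≤ X ω ^ 2}.indicator
        (fun _ => ENNReal.ofReal (Real.exp (((k : ℝ) + 1) / 4))) ω := fun ω => by
    refine le_trans ?_ (ENNReal.le_tsum ⌊X ω ^ 2⌋₊)
    rw [Set.indicator_of_mem (show ω ∈ {a | (⌊X ω ^ 2⌋₊ : ℝ) ≤ X a ^ 2} from
      Nat.floor_le (sq_nonneg (X ω)))]
    refine ENNReal.ofReal_le_ofReal (Real.exp_le_exp.2 ?_)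
    have := (Nat.lt_floor_add_one (X ω ^ 2)).le
    linarith
  calc _ ≤ _ := lintegral_mono hpt
    _ = ∑' k : ℕ, ENNReal.ofReal (Real.exp (((k : ℝ) + 1) / 4)) * μ {ω | (k : ℝ) ≤ X ω ^ 2} := by
      rw [lintegral_tsum fun k => (measurable_const.indicator (hmeas k)).aemeasurable]
      congr 1; ext k
      rw [lintegral_indicator_const (hmeas k)]
    _ ≤ ∑' k : ℕ, ENNReal.ofReal (2 * Real.exp (1 / 4) * Real.exp (-1 / 4) ^ k) := by
      refine ENNReal.tsum_le_tsum fun k => ?_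
      rw [← ofReal_measureReal, ← ENNReal.ofReal_mul (Real.exp_pos _).le]
      refine ENNReal.ofReal_le_ofReal ?_
      calc _ ≤ Real.exp (((k : ℝ) + 1) / 4) * (2 * Real.exp (-(k : ℝ) / 2)) :=
            mul_le_mul_of_nonneg_left (measureReal_le_sq_le h₁ h₂ k.cast_nonneg) (Real.exp_pos _).le
        _ = _ := by
          rw [← Real.exp_nat_mul, mul_left_comm, ← Real.exp_add, mul_assoc, ← Real.exp_add]
          congr 2; ring
    _ = _ := by
      rw [expSqBound, ENNReal.ofReal_tsum_of_nonneg (fun k => by positivity) summable_expSqBound]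

theorem integrable_exp_sq {X : Ω → ℝ} (hX : Measurable X)
    (h₁ : ∀ ε : ℝ, 0 ≤ ε → μ.real {ω | ε ≤ X ω} ≤ Real.exp (-ε ^ 2 / 2))
    (h₂ : ∀ ε : ℝ, 0 ≤ ε → μ.real {ω | ε ≤ -X ω} ≤ Real.exp (-ε ^ 2 / 2)) :
    Integrable (fun ω => Real.exp (X ω ^ 2 / 4)) μ :=
  ⟨by fun_prop, by
    rw [hasFiniteIntegral_iff_ofReal (.of_forall fun _ => (Real.exp_pos _).le)]
    exact (lintegral_exp_sq_le hX h₁ h₂).trans_lt ENNReal.ofReal_lt_top⟩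

theorem integral_exp_sq_le {X : Ω → ℝ} (hX : Measurable X)
    (h₁ : ∀ ε : ℝ, 0 ≤ ε → μ.real {ω | ε ≤ X ω} ≤ Real.exp (-ε ^ 2 / 2))
    (h₂ : ∀ ε : ℝ, 0 ≤ ε → μ.real {ω | ε ≤ -X ω} ≤ Real.exp (-ε ^ 2 / 2)) :
    ∫ ω, Real.exp (X ω ^ 2 / 4) ∂μ ≤ expSqBound := by
  rw [integral_eq_lintegral_of_nonneg_ae (.of_forall fun _ => (Real.exp_pos _).le) (by fun_prop)]
  exact ENNReal.toReal_le_of_le_ofReal (zero_le_one.trans one_le_expSqBound)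
    (lintegral_exp_sq_le hX h₁ h₂)

/-- A constant `K` with `𝔼 exp (l (X² - 1)) ≤ exp (K l²)` for `|l| ≤ 1 / 8` and every
unit-variance variable `X` whose tails are dominated by `exp (-ε² / 2)`. -/
noncomputable def varProxy : ℝ := 128 * Real.exp (1 / 4) * expSqBound

/-- `4 ≤ varProxy` keeps the Chernoff parameter `δ / (2 * varProxy)` within `1 / 8` for `δ ≤ 1`. -/
theorem four_le_varProxy : 4 ≤ varProxy := by
  have h1 : (1 : ℝ) ≤ Real.exp (1 / 4) := Real.one_le_exp (by norm_num)
  have h2 := one_le_expSqBound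
  have h3 := one_le_mul_of_one_le_of_one_le h1 h2
  rw [varProxy, mul_assoc]; linarith

theorem abs_exp_sub_one_sub_id_le_sq_mul_exp (x : ℝ) :
    |Real.exp x - 1 - x| ≤ x ^ 2 * Real.exp |x| := by
  have h := Complex.norm_exp_sub_sum_le_norm_mul_exp (x : ℂ) 2
  rw [Finset.sum_range_succ, Finset.sum_range_one] at h
  have h2 : Complex.exp (x : ℂ) - ((x : ℂ) ^ 0 / (Nat.factorial 0 : ℂ)
      + (x : ℂ) ^ 1 / (Nat.factorial 1 : ℂ)) = ((Real.exp x - 1 - x : ℝ) : ℂ) := by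
    push_cast [Nat.factorial]; ring
  rw [h2, Complex.norm_real, Complex.norm_real, Real.norm_eq_abs, Real.norm_eq_abs, sq_abs] at h
  exact h

theorem exp_mul_sub_one_le {z l : ℝ} (hz : 0 ≤ z) (hl : |l| ≤ 1 / 8) :
    Real.exp (l * (z - 1))
      ≤ 1 + l * (z - 1) + 128 * Real.exp (1 / 4) * l ^ 2 * Real.exp (z / 4) := by
  have h1 := (abs_le.1 (abs_exp_sub_one_sub_id_le_sq_mul_exp (l * (z - 1)))).2
  have h2 : |l * (z - 1)| ≤ (z + 1) / 8 := by
    rw [abs_mul]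
    have : |z - 1| ≤ z + 1 := abs_le.2 ⟨by linarith, by linarith⟩
    calc _ ≤ 1 / 8 * (z + 1) := mul_le_mul hl this (abs_nonneg _) (by norm_num)
      _ = _ := by ring
  have h3 : (z - 1) ^ 2 ≤ 128 * Real.exp ((z + 1) / 8) := by
    have := Real.quadratic_le_exp_of_nonneg (x := (z + 1) / 8) (by positivity)
    nlinarith
  have h4 : Real.exp (1 / 4) * Real.exp (z / 4)
      = Real.exp ((z + 1) / 8) * Real.exp ((z + 1) / 8) := by
    rw [← Real.exp_add, ← Real.exp_add]; congr 1; ring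
  have h5 : (l * (z - 1)) ^ 2 * Real.exp |l * (z - 1)|
      ≤ l ^ 2 * (128 * Real.exp ((z + 1) / 8)) * Real.exp ((z + 1) / 8) := by
    rw [mul_pow]
    exact mul_le_mul (mul_le_mul_of_nonneg_left h3 (sq_nonneg l)) (Real.exp_le_exp.2 h2)
      (Real.exp_pos _).le (by positivity)
  have h6 : l ^ 2 * (128 * Real.exp ((z + 1) / 8)) * Real.exp ((z + 1) / 8)
      = 128 * Real.exp (1 / 4) * l ^ 2 * Real.exp (z / 4) := by
    linear_combination (-128 * l ^ 2) * h4
  linarith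

theorem integrable_exp_mul_sq_sub_one {X : Ω → ℝ} (hX : Measurable X)
    (h₁ : ∀ ε : ℝ, 0 ≤ ε → μ.real {ω | ε ≤ X ω} ≤ Real.exp (-ε ^ 2 / 2))
    (h₂ : ∀ ε : ℝ, 0 ≤ ε → μ.real {ω | ε ≤ -X ω} ≤ Real.exp (-ε ^ 2 / 2))
    (hsq : Integrable (fun ω => X ω ^ 2) μ) {l : ℝ} (hl : |l| ≤ 1 / 8) :
    Integrable (fun ω => Real.exp (l * (X ω ^ 2 - 1))) μ := by
  refine Integrable.mono' (((integrable_const (1 : ℝ)).add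
    ((hsq.sub (integrable_const 1)).const_mul l)).add
    ((integrable_exp_sq hX h₁ h₂).const_mul (128 * Real.exp (1 / 4) * l ^ 2)))
    (by fun_prop) (.of_forall fun ω => ?_)
  rw [Real.norm_eq_abs, abs_of_pos (Real.exp_pos _)]
  exact exp_mul_sub_one_le (sq_nonneg _) hl

/-- Bernstein's condition for the centred square of a unit-variance sub-Gaussian variable. -/
theorem mgf_sq_sub_one_le {X : Ω → ℝ} (hX : Measurable X)
    (h₁ : ∀ ε : ℝ, 0 ≤ ε → μ.real {ω | ε ≤ X ω} ≤ Real.exp (-ε ^ 2 / 2))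
    (h₂ : ∀ ε : ℝ, 0 ≤ ε → μ.real {ω | ε ≤ -X ω} ≤ Real.exp (-ε ^ 2 / 2))
    (hsq : Integrable (fun ω => X ω ^ 2) μ) (hvar : ∫ ω, X ω ^ 2 ∂μ = 1) {l : ℝ}
    (hl : |l| ≤ 1 / 8) :
    mgf (fun ω => X ω ^ 2 - 1) μ l ≤ Real.exp (varProxy * l ^ 2) := by
  have hi₀ : Integrable (fun ω => l * (X ω ^ 2 - 1)) μ :=
    (hsq.sub (integrable_const 1)).const_mul l
  have hi₁ : Integrable (fun ω => 1 + l * (X ω ^ 2 - 1)) μ := (integrable_const (1 : ℝ)).add hi₀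
  have hi₂ := (integrable_exp_sq hX h₁ h₂).const_mul (128 * Real.exp (1 / 4) * l ^ 2)
  calc mgf (fun ω => X ω ^ 2 - 1) μ l
      ≤ ∫ ω, (1 + l * (X ω ^ 2 - 1)
          + 128 * Real.exp (1 / 4) * l ^ 2 * Real.exp (X ω ^ 2 / 4)) ∂μ :=
        integral_mono (integrable_exp_mul_sq_sub_one hX h₁ h₂ hsq hl) (hi₁.add hi₂)
          fun ω => exp_mul_sub_one_le (sq_nonneg _) hl
    _ = 1 + 128 * Real.exp (1 / 4) * l ^ 2 * ∫ ω, Real.exp (X ω ^ 2 / 4) ∂μ := by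
        rw [integral_add hi₁ hi₂, integral_const_mul,
          integral_add (integrable_const _) hi₀,
          integral_const_mul, integral_sub hsq (integrable_const _), hvar]
        simp
    _ ≤ 1 + varProxy * l ^ 2 := by
        have := mul_le_mul_of_nonneg_left (integral_exp_sq_le hX h₁ h₂)
          (show 0 ≤ 128 * Real.exp (1 / 4) * l ^ 2 by positivity)
        rw [varProxy]; linarith
    _ ≤ _ := by linarith [Real.add_one_le_exp (varProxy * l ^ 2)]

/-- Bernstein's inequality, in both directions, for sums of independent centred squares. -/
theorem measureReal_abs_sum_sq_sub_one_ge_le {m : ℕ} {X : Fin m → Ω → ℝ}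
    (hX : ∀ i, Measurable (X i)) (hind : iIndepFun X μ)
    (h₁ : ∀ i, ∀ ε : ℝ, 0 ≤ ε → μ.real {ω | ε ≤ X i ω} ≤ Real.exp (-ε ^ 2 / 2))
    (h₂ : ∀ i, ∀ ε : ℝ, 0 ≤ ε → μ.real {ω | ε ≤ -X i ω} ≤ Real.exp (-ε ^ 2 / 2))
    (hsq : ∀ i, Integrable (fun ω => X i ω ^ 2) μ) (hvar : ∀ i, ∫ ω, X i ω ^ 2 ∂μ = 1)
    {δ : ℝ} (hδ : 0 ≤ δ) (hδ1 : δ ≤ 1) :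
    μ.real {ω | m * δ ≤ |∑ i, (X i ω ^ 2 - 1)|}
      ≤ 2 * Real.exp (-(m * δ ^ 2 / (4 * varProxy))) := by
  have hK := four_le_varProxy
  have hK0 : 0 < varProxy := by linarith
  set Y : Fin m → Ω → ℝ := fun i ω => X i ω ^ 2 - 1 with hY
  have hYm : ∀ i, Measurable (Y i) := fun i => ((hX i).pow_const 2).sub_const 1
  have hYind : iIndepFun Y μ :=
    hind.comp (fun _ x => x ^ 2 - 1) fun _ => (measurable_id.pow_const 2).sub_const 1
  have hint : ∀ l : ℝ, |l| ≤ 1 / 8 →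
      Integrable (fun ω => Real.exp (l * (∑ i, Y i) ω)) μ := fun l hl =>
    hYind.integrable_exp_mul_sum hYm fun i _ =>
      integrable_exp_mul_sq_sub_one (hX i) (h₁ i) (h₂ i) (hsq i) hl
  have hmgf : ∀ l : ℝ, |l| ≤ 1 / 8 →
      mgf (∑ i, Y i) μ l ≤ Real.exp (m * (varProxy * l ^ 2)) := fun l hl => by
    rw [hYind.mgf_sum hYm]
    calc _ ≤ ∏ _i : Fin m, Real.exp (varProxy * l ^ 2) :=
          Finset.prod_le_prod (fun _ _ => mgf_nonneg) fun i _ =>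
            mgf_sq_sub_one_le (hX i) (h₁ i) (h₂ i) (hsq i) (hvar i) hl
      _ = _ := by rw [Finset.prod_const, Finset.card_univ, Fintype.card_fin, Real.exp_nat_mul]
  -- the minimizer of `l ↦ varProxy * l ^ 2 - l * δ`
  set l := δ / (2 * varProxy) with hl
  have hl0 : 0 ≤ l := by positivity
  have hl8 : l ≤ 1 / 8 := by
    rw [hl, div_le_iff₀ (by positivity)]; linarith
  have habs : |l| ≤ 1 / 8 := by rwa [abs_of_nonneg hl0]
  have habs' : |-l| ≤ 1 / 8 := by rwa [abs_neg]
  have hexp : -l * (m * δ) + m * (varProxy * l ^ 2) = -(m * δ ^ 2 / (4 * varProxy)) := by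
    rw [hl]; field_simp; ring
  have up : μ.real {ω | m * δ ≤ (∑ i, Y i) ω} ≤ Real.exp (-(m * δ ^ 2 / (4 * varProxy))) :=
    calc _ ≤ _ := measure_ge_le_exp_mul_mgf (m * δ) hl0 (hint l habs)
      _ ≤ _ := mul_le_mul_of_nonneg_left (hmgf l habs) (Real.exp_pos _).le
      _ = _ := by rw [← Real.exp_add, hexp]
  have low : μ.real {ω | (∑ i, Y i) ω ≤ -(m * δ)} ≤ Real.exp (-(m * δ ^ 2 / (4 * varProxy))) :=
    calc _ ≤ _ := measure_le_le_exp_mul_mgf (-(m * δ)) (neg_nonpos.2 hl0) (hint (-l) habs')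
      _ ≤ _ := mul_le_mul_of_nonneg_left (hmgf (-l) habs') (Real.exp_pos _).le
      _ = _ := by rw [← Real.exp_add, ← hexp]; congr 1; ring
  have hsub : {ω | m * δ ≤ |∑ i, (X i ω ^ 2 - 1)|}
      ⊆ {ω | m * δ ≤ (∑ i, Y i) ω} ∪ {ω | (∑ i, Y i) ω ≤ -(m * δ)} := fun ω hω => by
    rw [Set.mem_union, Set.mem_ofPred_eq, Set.mem_ofPred_eq, Finset.sum_apply]
    rcases le_abs.1 (Set.mem_ofPred_eq ▸ hω) with h | h
    · exact Or.inl h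
    · exact Or.inr (by linarith)
  calc _ ≤ _ := measureReal_mono hsub
    _ ≤ _ := measureReal_union_le _ _
    _ ≤ _ := by linarith

end Tail

/-! ### Concentration of sub-Gaussian sketches -/

theorem norm_sq_toEuclideanLin_eq_sum {Ω : Type*} {m n : ℕ} (S : Ω → Matrix (Fin m) (Fin n) ℝ)
    (ω : Ω) (u : EuclideanSpace ℝ (Fin n)) :
    ‖Matrix.toEuclideanLin (S ω) u‖ ^ 2 = ∑ i, inner ℝ (row S i ω) u ^ 2 := by
  rw [EuclideanSpace.real_norm_sq_eq]
  refine Finset.sum_congr rfl fun i _ => ?_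
  congr 1
  simp [row, Matrix.toLpLin_apply, Matrix.mulVec, dotProduct, PiLp.inner_apply, mul_comm]

section Sketch
variable {Ω : Type*} [MeasurableSpace Ω] {μ : Measure Ω}
  {S : Ω → Matrix (Fin m) (Fin n) ℝ}

theorem measurable_row (hS : Measurable S) (i : Fin m) : Measurable (row S i) :=
  (WithLp.measurable_toLp 2 (Fin n → ℝ)).comp
    ((measurable_pi_apply (X := fun _ : Fin m => Fin n → ℝ) i).comp hS)

theorem measurable_sketchDefect (hS : Measurable S) (u : EuclideanSpace ℝ (Fin n)) :
    Measurable fun ω => sketchDefect (S ω) u u := by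
  simp_rw [sketchDefect_apply, real_inner_self_eq_norm_sq (Matrix.toEuclideanLin _ u),
    norm_sq_toEuclideanLin_eq_sum S]
  have := measurable_row hS
  fun_prop

namespace IsSubGaussianSketch

theorem memLp_inner_row (h : IsSubGaussianSketch S μ) (i : Fin m) (u : EuclideanSpace ℝ (Fin n)) :
    MemLp (fun ω => inner ℝ (row S i ω) u) 2 μ :=
  (h.memLp i).inner_const u

variable [IsProbabilityMeasure μ]

/-- The rows are isotropic. -/
theorem integral_inner_row_sq (h : IsSubGaussianSketch S μ) (i : Fin m)
    (u : EuclideanSpace ℝ (Fin n)) : ∫ ω, inner ℝ (row S i ω) u ^ 2 ∂μ = ‖u‖ ^ 2 := by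
  have hmean : ∫ ω, inner ℝ (row S i ω) u ∂μ = 0 := by
    simp_rw [real_inner_comm u]
    rw [integral_inner (h.subGaussian i).integrable, (h.subGaussian i).zero_mean, inner_zero_right]
  have hcoord : ∀ j, MemLp (fun ω => row S i ω j) 2 μ := fun j => by
    simpa [EuclideanSpace.inner_single_right] using h.memLp_inner_row i (EuclideanSpace.single j 1)
  have hsum : (fun ω => inner ℝ (row S i ω) u) = fun ω => ∑ j, u j * row S i ω j := by
    ext ω; simp [PiLp.inner_apply]
  rw [← variance_of_integral_eq_zero (h.memLp_inner_row i u).aemeasurable hmean,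
    ← covariance_self (h.memLp_inner_row i u).aemeasurable, hsum,
    covariance_fun_sum_fun_sum (fun j => (hcoord j).const_mul (u j))
      fun j => (hcoord j).const_mul (u j)]
  simp_rw [covariance_const_mul_left, covariance_const_mul_right, h.cov]
  rw [EuclideanSpace.real_norm_sq_eq]
  simp [sq]

theorem measureReal_sketchDefect_gt_le (h : IsSubGaussianSketch S μ) (hm : m ≠ 0)
    (u : EuclideanSpace ℝ (Fin n)) {δ : ℝ} (hδ : 0 ≤ δ) (hδ1 : δ ≤ 1) :
    μ.real {ω | δ * ‖u‖ ^ 2 < |sketchDefect (S ω) u u|}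
      ≤ 2 * Real.exp (-(m * δ ^ 2 / (4 * varProxy))) := by
  rcases eq_or_ne u 0 with rfl | hu
  · simp; positivity
  have hu0 : 0 < ‖u‖ := norm_pos_iff.2 hu
  have hm0 : (0 : ℝ) < m := by exact_mod_cast Nat.pos_of_ne_zero hm
  set X : Fin m → Ω → ℝ := fun i ω => inner ℝ (row S i ω) u / ‖u‖ with hX
  have hind : iIndepFun X μ :=
    h.indep.comp (fun _ s => inner ℝ s u / ‖u‖) fun _ => by fun_prop
  have h₁ : ∀ i, ∀ ε : ℝ, 0 ≤ ε → μ.real {ω | ε ≤ X i ω} ≤ Real.exp (-ε ^ 2 / 2) := by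
    intro i ε hε
    simpa only [hX, le_div_iff₀ hu0] using (h.subGaussian i).tail u hu ε hε
  have h₂ : ∀ i, ∀ ε : ℝ, 0 ≤ ε → μ.real {ω | ε ≤ -X i ω} ≤ Real.exp (-ε ^ 2 / 2) := by
    intro i ε hε
    simpa only [hX, ← neg_div, le_div_iff₀ hu0, inner_neg_right, norm_neg] using
      (h.subGaussian i).tail (-u) (neg_ne_zero.2 hu) ε hε
  have hsq : ∀ i, Integrable (fun ω => X i ω ^ 2) μ := fun i => by
    simp only [hX, div_pow]
    exact (h.memLp_inner_row i u).integrable_sq.div_const _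
  have hvar : ∀ i, ∫ ω, X i ω ^ 2 ∂μ = 1 := fun i => by
    simp only [hX, div_pow]
    rw [integral_div, h.integral_inner_row_sq, div_self (by positivity)]
  have hrow := measurable_row h.measurable
  refine le_trans (measureReal_mono fun ω hω => ?_)
    (measureReal_abs_sum_sq_sub_one_ge_le (fun i => by fun_prop) hind h₁ h₂ hsq hvar hδ hδ1)
  have hdef : ∑ i, (X i ω ^ 2 - 1) = m / ‖u‖ ^ 2 * sketchDefect (S ω) u u := by
    rw [sketchDefect_apply, real_inner_self_eq_norm_sq, real_inner_self_eq_norm_sq,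
      norm_sq_toEuclideanLin_eq_sum S, Finset.sum_sub_distrib]
    simp only [hX, div_pow, ← Finset.sum_div, Finset.sum_const, Finset.card_univ, Fintype.card_fin,
      nsmul_eq_mul]
    field_simp
  rw [Set.mem_ofPred_eq, hdef, abs_mul, abs_of_pos (by positivity), div_mul_eq_mul_div,
    le_div_iff₀ (by positivity), mul_assoc]
  exact mul_le_mul_of_nonneg_left (le_of_lt hω) hm0.le

/-- A sketch whose size is a large multiple of `d / ρ²` preserves a subspace of dimension at most
`d` with relative error `ρ / 2`, except on an event of exponentially small probability: the factor
`25 ^ d` of the union bound is absorbed by half of the exponent. -/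
theorem exists_event_preservesInner (h : IsSubGaussianSketch S μ) (hm : m ≠ 0)
    (U : Submodule ℝ (EuclideanSpace ℝ (Fin n))) (hU : finrank ℝ U ≤ d) {ρ : ℝ} (hρ : 0 < ρ)
    (hρ1 : ρ ≤ 1) (hmd : 512 * varProxy * Real.log 25 * d ≤ m * ρ ^ 2) :
    ∃ G : Set Ω, MeasurableSet G ∧ μ.real Gᶜ ≤ 4 * Real.exp (-(m * ρ ^ 2 / (512 * varProxy))) ∧
      ∀ ω ∈ G, PreservesInner (S ω) U (ρ / 2) := by
  have hK : 0 < varProxy := by linarith [four_le_varProxy]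
  obtain ⟨T, hTcard, hT⟩ := exists_test_vectors U
  refine ⟨⋂ u ∈ T, {ω | |sketchDefect (S ω) u u| ≤ ρ / 8 * ‖u‖ ^ 2}, ?_, ?_, ?_⟩
  · exact T.measurableSet_biInter fun u _ =>
      measurableSet_le (measurable_sketchDefect h.measurable u).abs measurable_const
  · have hcompl : (⋂ u ∈ T, {ω | |sketchDefect (S ω) u u| ≤ ρ / 8 * ‖u‖ ^ 2})ᶜ
        = ⋃ u ∈ T, {ω | ρ / 8 * ‖u‖ ^ 2 < |sketchDefect (S ω) u u|} := by
      ext ω; simp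
    have hcard : (T.card : ℝ) ≤ 2 * Real.exp (Real.log 25 * d) := by
      calc (T.card : ℝ) ≤ 2 * 25 ^ finrank ℝ U := by exact_mod_cast hTcard
        _ ≤ 2 * 25 ^ d := by gcongr; norm_num
        _ = _ := by rw [mul_comm (Real.log 25), Real.exp_nat_mul, Real.exp_log (by norm_num)]
    rw [hcompl]
    calc _ ≤ _ := measureReal_biUnion_finset_le T _
      _ ≤ ∑ _u ∈ T, 2 * Real.exp (-(m * (ρ / 8) ^ 2 / (4 * varProxy))) :=
        Finset.sum_le_sum fun u _ =>
          h.measureReal_sketchDefect_gt_le hm u (by positivity) (by linarith)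
      _ = T.card * (2 * Real.exp (-(m * (ρ / 8) ^ 2 / (4 * varProxy)))) := by
        rw [Finset.sum_const, nsmul_eq_mul]
      _ ≤ 2 * Real.exp (Real.log 25 * d)
          * (2 * Real.exp (-(m * (ρ / 8) ^ 2 / (4 * varProxy)))) := by gcongr
      _ = 4 * Real.exp (Real.log 25 * d - 2 * (m * ρ ^ 2 / (512 * varProxy))) := by
        rw [mul_mul_mul_comm, ← Real.exp_add]
        congr 2
        · norm_num
        · field_simp; ring
      _ ≤ _ := by
        have : Real.log 25 * d ≤ m * ρ ^ 2 / (512 * varProxy) := by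
          rw [le_div_iff₀ (by positivity)]; linarith
        gcongr
        linarith
  · intro ω hω
    have := hT m (S ω) (ρ / 8) (by positivity) (by simpa using hω)
    rwa [show 4 * (ρ / 8) = ρ / 2 by ring] at this

end IsSubGaussianSketch
end Sketch

/-! ### Iteration of the rounds -/

section Run
variable {N : ℕ} {A : Matrix (Fin n) (Fin d) ℝ} {y : EuclideanSpace ℝ (Fin n)}
  {S : Fin N → Matrix (Fin m) (Fin n) ℝ}

theorem exists_isRun
    (h : ∀ t (x₀ : EuclideanSpace ℝ (Fin d)), ∃ x, IsMinOn (objective A y (S t) x₀) Set.univ x) :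
    ∃ x, IsRun Set.univ A y S x := by
  choose f hf using h
  exact ⟨Fin.induction (motive := fun _ => EuclideanSpace ℝ (Fin d)) 0 f, rfl, fun t =>
    ⟨Set.mem_univ _, hf t _⟩⟩

theorem IsRun.norm_le {x : Fin (N + 1) → EuclideanSpace ℝ (Fin d)} (hx : IsRun Set.univ A y S x)
    {ρ : ℝ} (hρ : 0 ≤ ρ) {z : EuclideanSpace ℝ (Fin d)}
    (h : ∀ t (x₀ x₁ : EuclideanSpace ℝ (Fin d)), IsMinOn (objective A y (S t) x₀) Set.univ x₁ →
      ‖Matrix.toEuclideanLin A (x₁ - z)‖ ≤ ρ * ‖Matrix.toEuclideanLin A (x₀ - z)‖) :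
    ‖Matrix.toEuclideanLin A (x (Fin.last N) - z)‖ ≤ ρ ^ N * ‖Matrix.toEuclideanLin A z‖ := by
  have key : ∀ t : Fin (N + 1), ‖Matrix.toEuclideanLin A (x t - z)‖
      ≤ ρ ^ (t : ℕ) * ‖Matrix.toEuclideanLin A z‖ := by
    intro t
    induction t using Fin.induction with
    | zero => simp [hx.1]
    | succ t ih =>
      calc _ ≤ _ := h t _ _ (hx.2 t).2
        _ ≤ _ := mul_le_mul_of_nonneg_left ih hρ
        _ = _ := by rw [Fin.val_succ, Fin.val_castSucc, pow_succ']; ring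
  simpa using key (Fin.last N)

end Run

theorem pow_mul_le_of_eq_ceil_log {a σ ρ : ℝ} (ha : 0 ≤ a) (hσ : 0 < σ) (hρ : 0 < ρ) (hρ1 : ρ < 1)
    {N : ℕ} (hN : N = 1 + ⌈Real.log (a / σ) / Real.log (1 / ρ)⌉₊) : ρ ^ N * a ≤ σ := by
  rcases ha.eq_or_lt with rfl | ha
  · simpa using hσ.le
  have hlog : 0 < Real.log (1 / ρ) := Real.log_pos (by rw [lt_div_iff₀ hρ]; linarith)
  have h1 : Real.log (a / σ) / Real.log (1 / ρ) ≤ N := by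
    refine (Nat.le_ceil _).trans ?_
    rw [hN]; push_cast; linarith
  rw [div_le_iff₀ hlog, ← Real.log_pow, Real.log_le_log_iff (by positivity) (by positivity),
    one_div, inv_pow, div_le_iff₀ hσ, ← div_eq_inv_mul, le_div_iff₀ (by positivity)] at h1
  linarith

theorem sqrt_mul_predNorm {n d : ℕ} (hn : 1 ≤ n) (A : Matrix (Fin n) (Fin d) ℝ)
    (v : EuclideanSpace ℝ (Fin d)) :
    √(n : ℝ) * predNorm A v = ‖Matrix.toEuclideanLin A v‖ := by
  have : 0 < √(n : ℝ) := Real.sqrt_pos.2 (by exact_mod_cast hn)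
  rw [predNorm, mul_div_cancel₀ _ this.ne']

theorem predNorm_sub_le {n d : ℕ} (A : Matrix (Fin n) (Fin d) ℝ)
    (u v w : EuclideanSpace ℝ (Fin d)) :
    predNorm A (u - w) ≤ predNorm A (u - v) + predNorm A (v - w) := by
  rw [predNorm, predNorm, predNorm, ← add_div, ← sub_add_sub_cancel u v w, map_add]
  gcongr
  exact norm_add_le _ _

end IHS

theorem corollary2 :
    ∃ c₀ c₁ c₂ : ℝ, 0 < c₀ ∧ 0 < c₁ ∧ 0 < c₂ ∧
      ∀ (n d : ℕ), 1 ≤ n → 1 ≤ d →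
      ∀ (A : Matrix (Fin n) (Fin d) ℝ) (xstar : EuclideanSpace ℝ (Fin d))
        (w y : EuclideanSpace ℝ (Fin n)), y = Matrix.toEuclideanLin A xstar + w →
      ∀ (σ ρ : ℝ), 0 < σ → 0 < ρ → ρ < 1 / 2 →
      ∀ xLS : EuclideanSpace ℝ (Fin d), IHS.IsLeastSquaresSol Set.univ A y xLS →
      ∀ N : ℕ, N = 1 + ⌈Real.log (√(n : ℝ) * IHS.predNorm A xLS / σ) / Real.log (1 / ρ)⌉₊ →
      ∀ m : ℕ, c₀ / ρ ^ 2 * (d : ℝ) ≤ (m : ℝ) →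
      ∀ (Ω : Type*) [MeasurableSpace Ω] (μ : Measure Ω) [IsProbabilityMeasure μ]
        (S : Fin N → Ω → Matrix (Fin m) (Fin n) ℝ),
        (∀ t, IHS.IsSubGaussianSketch (S t) μ) → iIndepFun S μ →
      ∃ G : Set Ω, MeasurableSet G ∧
        1 - c₁ * (N : ℝ) * Real.exp (-c₂ * ((m : ℝ) * ρ ^ 2)) < μ.real G ∧
        (2 ≤ d →
          1 - c₁ * (N : ℝ) * Real.exp (-c₂ * ((m : ℝ) * ρ ^ 2 / Real.log (d : ℝ) ^ 4))
            < μ.real G) ∧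
        ∀ ω ∈ G,
          (∃ x : Fin (N + 1) → EuclideanSpace ℝ (Fin d),
            IHS.IsRun Set.univ A y (fun t => S t ω) x) ∧
          ∀ x : Fin (N + 1) → EuclideanSpace ℝ (Fin d),
            IHS.IsRun Set.univ A y (fun t => S t ω) x →
              IHS.predNorm A (x (Fin.last N) - xLS) ≤ √(σ ^ 2 * (d : ℝ) / (n : ℝ)) ∧
              IHS.predNorm A (x (Fin.last N) - xstar) ≤
                √(σ ^ 2 * (d : ℝ) / (n : ℝ)) + IHS.predNorm A (xLS - xstar) := by
  have hK : 0 < IHS.varProxy := by linarith [IHS.four_le_varProxy]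
  have hlog25 : 0 < Real.log 25 := Real.log_pos (by norm_num)
  have hlog2 : 0 < Real.log 2 := Real.log_pos (by norm_num)
  have hlog2' : Real.log 2 ≤ 1 := by linarith [Real.log_two_lt_d9]
  -- `log 2 ≤ min 1 (log d)` for `d ≥ 2`, so this `c₂` serves both probability bounds
  refine ⟨512 * IHS.varProxy * Real.log 25, 5, Real.log 2 ^ 4 / (512 * IHS.varProxy),
    by positivity, by norm_num, by positivity, ?_⟩
  intro n d hn hd A xstar w y _ σ ρ hσ hρ hρ' xLS hLS N hN m hm Ω _ μ _ S hS _
  have hd0 : (0 : ℝ) < d := by exact_mod_cast hd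
  have hm0 : m ≠ 0 := by
    rintro rfl
    have : 0 < 512 * IHS.varProxy * Real.log 25 / ρ ^ 2 * (d : ℝ) := by positivity
    simp only [Nat.cast_zero] at hm
    linarith
  have hmd : 512 * IHS.varProxy * Real.log 25 * d ≤ m * ρ ^ 2 := by
    rwa [div_mul_eq_mul_div, div_le_iff₀ (by positivity)] at hm
  have hU : Module.finrank ℝ (LinearMap.range (Matrix.toEuclideanLin A)) ≤ d := by
    simpa using LinearMap.finrank_range_le (Matrix.toEuclideanLin A)
  choose G hGm hGc hG using fun t =>
    (hS t).exists_event_preservesInner hm0 _ hU hρ (by linarith) hmd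
  set e := m * ρ ^ 2 / (512 * IHS.varProxy) with he
  have hN0 : (0 : ℝ) < N := by rw [hN]; positivity
  have hprob : 1 - 4 * N * Real.exp (-e) ≤ μ.real (⋂ t, G t) := by
    have h1 : μ.real (⋂ t, G t)ᶜ ≤ 4 * N * Real.exp (-e) := by
      rw [Set.compl_iInter]
      calc _ ≤ _ := measureReal_iUnion_fintype_le _
        _ ≤ ∑ _t : Fin N, 4 * Real.exp (-e) := Finset.sum_le_sum fun t _ => hGc t
        _ = _ := by rw [Finset.sum_const, Finset.card_univ, Fintype.card_fin, nsmul_eq_mul]; ring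
    rw [measureReal_compl (.iInter hGm), probReal_univ] at h1
    linarith
  have hprob' : ∀ r : ℝ, r ≤ e → 1 - 5 * N * Real.exp (-r) < μ.real (⋂ t, G t) := by
    intro r hr
    have h1 : Real.exp (-e) ≤ Real.exp (-r) := Real.exp_le_exp.2 (by linarith)
    have h2 := mul_le_mul_of_nonneg_left h1 hN0.le
    have h3 := mul_pos hN0 (Real.exp_pos (-r))
    linarith
  have he0 : 0 ≤ e := by positivity
  refine ⟨⋂ t, G t, .iInter hGm, ?_, fun hd2 => ?_, fun ω hω => ?_⟩
  · rw [neg_mul]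
    refine hprob' _ ?_
    calc Real.log 2 ^ 4 / (512 * IHS.varProxy) * (m * ρ ^ 2) = Real.log 2 ^ 4 * e := by
          rw [he]; ring
      _ ≤ 1 * e := mul_le_mul_of_nonneg_right (pow_le_one₀ hlog2.le hlog2') he0
      _ = e := one_mul e
  · rw [neg_mul]
    refine hprob' _ ?_
    have h1 : Real.log 2 ≤ Real.log d := Real.log_le_log (by norm_num) (by exact_mod_cast hd2)
    have h2 : 0 < Real.log d := hlog2.trans_le h1
    calc Real.log 2 ^ 4 / (512 * IHS.varProxy) * (m * ρ ^ 2 / Real.log d ^ 4)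
        = Real.log 2 ^ 4 / Real.log d ^ 4 * e := by rw [he]; ring
      _ ≤ 1 * e := mul_le_mul_of_nonneg_right
          (div_le_one_of_le₀ (pow_le_pow_left₀ hlog2.le h1 4) (by positivity)) he0
      _ = e := one_mul e
  · have hpres := fun t => hG t ω (Set.mem_iInter.1 hω t)
    refine ⟨IHS.exists_isRun fun t x₀ =>
      (hpres t).exists_isMinOn_objective (by linarith) hm0 y x₀, fun x hx => ?_⟩
    rw [IHS.sqrt_mul_predNorm hn] at hN
    have h1 : ‖Matrix.toEuclideanLin A (x (Fin.last N) - xLS)‖ ≤ σ :=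
      (hx.norm_le hρ.le fun t x₀ x₁ => (hpres t).norm_sub_le hn hρ hρ' hLS).trans
        (IHS.pow_mul_le_of_eq_ceil_log (norm_nonneg _) hσ hρ (by linarith) hN)
    have h2 : IHS.predNorm A (x (Fin.last N) - xLS) ≤ √(σ ^ 2 * (d : ℝ) / (n : ℝ)) := by
      rw [IHS.predNorm, Real.sqrt_div (by positivity), Real.sqrt_mul (sq_nonneg σ),
        Real.sqrt_sq hσ.le]
      gcongr
      exact h1.trans (le_mul_of_one_le_right hσ.le (Real.one_le_sqrt.2 (by exact_mod_cast hd)))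
    exact ⟨h2, (IHS.predNorm_sub_le A _ xLS _).trans (by gcongr)⟩
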